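/- Let $p\in(0,\tfrac12)$ and consider a chain of nodes $0,1,\dots,m$ with $m\ge 1$. Node $0$ is given a uniformly distributed bit $\Theta\in\{0,1\}$. At each time $i\in\{1,\dots,n\}$, each node $j\in\{0,\dots,m-1\}$ sends one bit $X_{i,j}$ to node $j+1$ through a binary symmetric channel with crossover probability $p$, whose output is denoted $Y_{i,j}$; all channel uses are memoryless and independent. The bit $X_{i,0}$ is a function of $\Theta$ and, for $1\le j\le m-1$, the bit $X_{i,j}$ is a function of $Y_{1,j-1},\dots,Y_{i-1,j-1}$. After time $n$, node $m$ outputs an estimate $\hat\Theta\in\{0,1\}$, a function of $Y_{1,m-1},\dots,Y_{n,m-1}$. A choice of all these functions is a protocol of block length $n$. For $\varepsilon\in(0,\tfrac12)$ let $n^*_\varepsilon(m,p)$ be the smallest $n$ for which some protocol of block length $n$ satisfies $\mathbb P(\hat\Theta\ne\Theta)\le\varepsilon$ (with $n^*_\varepsilon(m,p)=\infty$ if there is none), and define the information velocity (the standard choice being $\varepsilon=\tfrac13$) by $$v_\varepsilon(p)=\limsup_{m\to\infty}\frac{m}{n^*_\varepsilon(m,p)}.$$ Then for every $\delta\in(0,1)$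 and every $\varepsilon\in(0,\tfrac12)$, $$v_\varepsilon\!\left(\tfrac{1-\delta}{2}\right)\le\delta^2 .$$ -/

import Mathlib

namespace RelayChain

/-- A protocol of block length `n` on a chain with `r` relays, that is, with `m = r + 1` hops and
nodes `0, …, r + 1`. Links are indexed by `Fin (r + 1)`: link `j` goes from node `j` to node `j + 1`.
Node `0` knows the bit `θ`; the relay indexed by `j : Fin r` is node `j + 1`, and what it sends at a
time depends only on what it received at strictly earlier times; node `r + 1` decodes after `n`
time steps. -/
structure Protocol (r n : ℕ) where
  /-- The bit that node `0` sends at time `i`. -/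
  encode : (i : Fin n) → (θ : Bool) → Bool
  /-- The bit that node `j + 1` sends at time `i`, given what it received before time `i`. -/
  relay : (j : Fin r) → (i : Fin n) → (past : Fin (i : ℕ) → Bool) → Bool
  /-- The estimate that node `r + 1` forms from the `n` bits it received. -/
  decode : (received : Fin n → Bool) → Bool

/-- Transition probability of the binary symmetric channel with crossover probability `p`. -/
noncomputable def bsc (p : ℝ) (x y : Bool) : ℝ := if y = x then 1 - p else p

namespace Protocol

variable {r n : ℕ}

/-- The bit put on link `j` at time `i`, where `y j i` is the output of link `j` at time `i`. -/
def input (P : Protocol r n) (θ : Bool) (y : Fin (r + 1) → Fin n → Bool) :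
    Fin (r + 1) → Fin n → Bool :=
  Fin.cases (fun i => P.encode i θ)
    (fun j i => P.relay j i (fun t => y j.castSucc (Fin.castLE i.isLt.le t)))

/-- The joint probability that the uniform bit equals `θ` and that the link outputs equal `y`, when
all transmissions pass through independent memoryless binary symmetric channels. -/
noncomputable def jointProb (P : Protocol r n) (p : ℝ) (θ : Bool)
    (y : Fin (r + 1) → Fin n → Bool) : ℝ :=
  1 / 2 * ∏ j, ∏ i, bsc p (P.input θ y j i) (y j i)

/-- The probability that the estimate of the last node differs from the bit. -/
noncomputable def errorProb (P : Protocol r n) (p : ℝ) : ℝ :=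
  ∑ θ : Bool, ∑ y : Fin (r + 1) → Fin n → Bool,
    if P.decode (y (Fin.last r)) ≠ θ then P.jointProb p θ y else 0

end Protocol

/-- The least block length for which some protocol with `r` relays (`r + 1` hops) has error
probability at most `ε`; it is `⊤` if there is no such block length. -/
noncomputable def minBlockLength (ε p : ℝ) (r : ℕ) : ℕ∞ :=
  sInf {N : ℕ∞ | ∃ n : ℕ, N = n ∧ ∃ P : Protocol r n, P.errorProb p ≤ ε}

open scoped ENNReal in
/-- The information velocity at error level `ε`: the upper limit of the ratio of the number `r + 1`
of hops to the least block length, as the number of hops tends to infinity. -/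
noncomputable def informationVelocity (ε p : ℝ) : ℝ≥0∞ :=
  Filter.limsup (fun r : ℕ => ((r + 1 : ℕ) : ℝ≥0∞) / (minBlockLength ε p r : ℝ≥0∞)) Filter.atTop

end RelayChain

/-!
Encode the source bit as a sign. The chi-square information about this sign carried by an
observation `u` is the second moment of the conditional expectation of the sign given `u`. Let
`I r n` be the information carried by the first `n` outputs of link `r`. For `0 < r`, the next bit
on that link is a function of the first `n` outputs of the previous link, and it passes through a
binary symmetric channel, which contracts the information by `η = (1 - 2 * p) ^ 2`. Applied
conditionally on the outputs received so far, this yields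
`I (r + 1) (n + 1) ≤ (1 - η) * I (r + 1) n + η * I r n`:
the information travels at most as fast as a walk that advances with probability `η` at each time.
Chernoff's bound for this walk, `c ^ (r + 1) * I r n ≤ (1 + η * (c - 1)) ^ n`, makes `I r n` small
once `n / r` stays below `1 / η`, whereas an error probability at most `ε` forces
`I r n ≥ (1 - 2 * ε) ^ 2`.
-/

namespace RelayChain

open Finset Matrix

theorem sum_snoc {α β : Type*} [Fintype α] [AddCommMonoid β] {n : ℕ}
    (f : (Fin (n + 1) → α) → β) :
    ∑ w, f w = ∑ v : Fin n → α, ∑ a, f (Fin.snoc v a) := by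
  rw [← (Fin.snocEquiv fun _ : Fin (n + 1) ↦ α).sum_comp, Fintype.sum_prod_type, sum_comm]
  rfl

section ChiSquare

variable {U V : Type*}

/-- The chi-square information `∑ u, N u ^ 2 / M u` about a sign. Here `M u` is the probability of
the observation `u`, and `N u` is the expectation of the sign on that event, so that `|N u| ≤ M u`
and the terms with `M u = 0` vanish. -/
noncomputable def chiSq [Fintype U] (N M : U → ℝ) : ℝ := ∑ u, N u ^ 2 / M u

theorem sq_sum_le_sum_mul_sum_sq_div {s : Finset U} {N M : U → ℝ} (h : ∀ u ∈ s, |N u| ≤ M u) :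
    (∑ u ∈ s, N u) ^ 2 ≤ (∑ u ∈ s, M u) * ∑ u ∈ s, N u ^ 2 / M u := by
  have hM : ∀ u ∈ s, 0 ≤ M u := fun u hu ↦ (abs_nonneg _).trans (h u hu)
  refine sum_sq_le_sum_mul_sum_of_sq_le_mul s hM
    (fun u hu ↦ div_nonneg (sq_nonneg _) (hM u hu)) fun u hu ↦ ?_
  rcases (hM u hu).eq_or_lt with h0 | hpos
  · have hN : N u = 0 := abs_nonpos_iff.1 ((h u hu).trans h0.ge)
    simp [hN]
  · rw [mul_div_cancel₀ _ hpos.ne']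

theorem sq_sum_div_sum_le_sum_sq_div {s : Finset U} {N M : U → ℝ} (h : ∀ u ∈ s, |N u| ≤ M u) :
    (∑ u ∈ s, N u) ^ 2 / ∑ u ∈ s, M u ≤ ∑ u ∈ s, N u ^ 2 / M u := by
  have hM : ∀ u ∈ s, 0 ≤ M u := fun u hu ↦ (abs_nonneg _).trans (h u hu)
  refine div_le_of_le_mul₀ (sum_nonneg hM)
    (sum_nonneg fun u hu ↦ div_nonneg (sq_nonneg _) (hM u hu)) ?_
  rw [mul_comm]
  exact sq_sum_le_sum_mul_sum_sq_div h

theorem sum_chiSq_mul_stochastic [Fintype U] [Fintype V] (N M : U → ℝ) {K : Matrix U V ℝ}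
    (hK : ∀ u, ∑ v, K u v = 1) :
    ∑ v, chiSq (fun u ↦ N u * K u v) (fun u ↦ M u * K u v) = chiSq N M := by
  have hterm (u : U) (v : V) : (N u * K u v) ^ 2 / (M u * K u v) = N u ^ 2 / M u * K u v := by
    rw [mul_pow, mul_div_mul_comm, sq (K u v), mul_self_div_self]
  simp only [chiSq, hterm]
  rw [sum_comm]
  simp only [← mul_sum, hK, mul_one]

theorem abs_vecMul_le [Fintype U] {N M : U → ℝ} (h : ∀ u, |N u| ≤ M u) {K : Matrix U V ℝ}
    (hK : ∀ u v, 0 ≤ K u v) (v : V) : |(N ᵥ* K) v| ≤ (M ᵥ* K) v := by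
  refine (abs_sum_le_sum_abs _ _).trans (sum_le_sum fun u _ ↦ ?_)
  rw [abs_mul, abs_of_nonneg (hK u v)]
  exact mul_le_mul_of_nonneg_right (h u) (hK u v)

theorem sum_vecMul_stochastic [Fintype U] [Fintype V] (N : U → ℝ) {K : Matrix U V ℝ}
    (hK : ∀ u, ∑ v, K u v = 1) :
    ∑ v, (N ᵥ* K) v = ∑ u, N u := by
  simp only [vecMul, dotProduct]
  rw [sum_comm]
  simp only [← mul_sum, hK, mul_one]

end ChiSquare

section BinarySymmetricChannel

variable {p : ℝ}

theorem bsc_nonneg (hp0 : 0 ≤ p) (hp1 : p ≤ 1) (x y : Bool) : 0 ≤ bsc p x y := by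
  unfold bsc
  split_ifs <;> linarith

theorem sum_bsc (p : ℝ) (x : Bool) : ∑ y, bsc p x y = 1 := by
  cases x <;> simp [bsc]

theorem sq_div_add_sq_div {F : Type*} [Field F] (a b : F) {A B : F} (hA : A ≠ 0) (hB : B ≠ 0)
    (hAB : A + B ≠ 0) :
    a ^ 2 / A + b ^ 2 / B = (a + b) ^ 2 / (A + B) + (a * B - b * A) ^ 2 / (A * B * (A + B)) := by
  field_simp
  ring

-- By `sq_div_add_sq_div`, both sides exceed `(a + b) ^ 2 / (A + B)` by a multiple of
-- `(a * B - b * A) ^ 2`: the channel scales `a * B - b * A` by `1 - 2 * p` and increases `A * B`.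
theorem sq_div_add_sq_div_bsc_le_of_pos (hp0 : 0 ≤ p) (hp1 : p ≤ 1) (a b : ℝ) {A B : ℝ}
    (hA : 0 < A) (hB : 0 < B) :
    ((1 - p) * a + p * b) ^ 2 / ((1 - p) * A + p * B) +
        (p * a + (1 - p) * b) ^ 2 / (p * A + (1 - p) * B) ≤
      (1 - (1 - 2 * p) ^ 2) * ((a + b) ^ 2 / (A + B)) +
        (1 - 2 * p) ^ 2 * (a ^ 2 / A + b ^ 2 / B) := by
  obtain ⟨A', hA'⟩ : ∃ A', A' = (1 - p) * A + p * B := ⟨_, rfl⟩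
  obtain ⟨B', hB'⟩ : ∃ B', B' = p * A + (1 - p) * B := ⟨_, rfl⟩
  have hprod : A * B ≤ A' * B' := by
    have : A' * B' = A * B + p * (1 - p) * (A - B) ^ 2 := by rw [hA', hB']; ring
    rw [this]
    exact le_add_of_nonneg_right (mul_nonneg (mul_nonneg hp0 (sub_nonneg.2 hp1)) (sq_nonneg _))
  have hA'pos : 0 < A' := by rw [hA']; nlinarith
  have hB'pos : 0 < B' := by rw [hB']; nlinarith
  have hABpos : 0 < A + B := add_pos hA hB
  have hsum : A' + B' = A + B := by rw [hA', hB']; ring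
  have hcross : ((1 - p) * a + p * b) * B' - (p * a + (1 - p) * b) * A' =
      (1 - 2 * p) * (a * B - b * A) := by rw [hA', hB']; ring
  rw [← hA', ← hB', sq_div_add_sq_div _ _ hA'pos.ne' hB'pos.ne' (hsum ▸ hABpos.ne'),
    sq_div_add_sq_div a b hA.ne' hB.ne' hABpos.ne', hcross, hsum]
  calc ((1 - p) * a + p * b + (p * a + (1 - p) * b)) ^ 2 / (A + B) +
        ((1 - 2 * p) * (a * B - b * A)) ^ 2 / (A' * B' * (A + B))
      ≤ ((1 - p) * a + p * b + (p * a + (1 - p) * b)) ^ 2 / (A + B) +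
        ((1 - 2 * p) * (a * B - b * A)) ^ 2 / (A * B * (A + B)) := by gcongr
    _ = _ := by ring

theorem sq_div_add_sq_div_bsc_le (hp0 : 0 ≤ p) (hp1 : p ≤ 1) {a b A B : ℝ} (ha : |a| ≤ A)
    (hb : |b| ≤ B) :
    ((1 - p) * a + p * b) ^ 2 / ((1 - p) * A + p * B) +
        (p * a + (1 - p) * b) ^ 2 / (p * A + (1 - p) * B) ≤
      (1 - (1 - 2 * p) ^ 2) * ((a + b) ^ 2 / (A + B)) +
        (1 - 2 * p) ^ 2 * (a ^ 2 / A + b ^ 2 / B) := by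
  have hscale (x c C : ℝ) : (x * c) ^ 2 / (x * C) = x * (c ^ 2 / C) := by
    rw [mul_pow, mul_div_mul_comm, sq x, mul_self_div_self]
  rcases ((abs_nonneg a).trans ha).eq_or_lt with rfl | hA
  · obtain rfl : a = 0 := abs_nonpos_iff.1 ha
    simp only [mul_zero, zero_add, hscale]
    linarith
  rcases ((abs_nonneg b).trans hb).eq_or_lt with rfl | hB
  · obtain rfl : b = 0 := abs_nonpos_iff.1 hb
    simp only [mul_zero, add_zero, hscale]
    linarith
  exact sq_div_add_sq_div_bsc_le_of_pos hp0 hp1 a b hA hB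

variable {U V : Type*} [Fintype U] {N M : U → ℝ}

theorem chiSq_bsc_le (hp0 : 0 ≤ p) (hp1 : p ≤ 1) (h : ∀ u, |N u| ≤ M u) (x : U → Bool) :
    chiSq (fun b ↦ ∑ u, N u * bsc p (x u) b) (fun b ↦ ∑ u, M u * bsc p (x u) b) ≤
      (1 - (1 - 2 * p) ^ 2) * ((∑ u, N u) ^ 2 / ∑ u, M u) + (1 - 2 * p) ^ 2 * chiSq N M := by
  have hfiber (f : U → ℝ) : ∑ u, f u = ∑ u with x u = true, f u + ∑ u with x u = false, f u := by
    rw [← sum_fiberwise _ x, Fintype.sum_bool]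
  have hsend (f : U → ℝ) (b : Bool) : ∑ u, f u * bsc p (x u) b =
      bsc p true b * (∑ u with x u = true, f u) + bsc p false b * ∑ u with x u = false, f u := by
    rw [hfiber, mul_sum, mul_sum]
    congr 1 <;> refine sum_congr rfl fun u hu ↦ ?_ <;> rw [(mem_filter.1 hu).2, mul_comm]
  have habs (b : Bool) : |∑ u with x u = b, N u| ≤ ∑ u with x u = b, M u :=
    (abs_sum_le_sum_abs _ _).trans (sum_le_sum fun u _ ↦ h u)
  have hgroup (b : Bool) : (∑ u with x u = b, N u) ^ 2 / ∑ u with x u = b, M u ≤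
      ∑ u with x u = b, N u ^ 2 / M u := sq_sum_div_sum_le_sum_sq_div fun u _ ↦ h u
  have hcontr := sq_div_add_sq_div_bsc_le hp0 hp1 (habs true) (habs false)
  simp only [chiSq, Fintype.sum_bool, hsend]
  rw [hfiber N, hfiber M, hfiber fun u ↦ N u ^ 2 / M u]
  simp only [bsc, if_true, Bool.true_eq_false, Bool.false_eq_true, if_false]
  refine hcontr.trans ?_
  gcongr
  exacts [hgroup true, hgroup false]

theorem sum_chiSq_mul_bsc_le [Fintype V] (hp0 : 0 ≤ p) (hp1 : p ≤ 1) (h : ∀ u, |N u| ≤ M u)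
    {K : Matrix U V ℝ} (hK0 : ∀ u v, 0 ≤ K u v) (hK1 : ∀ u, ∑ v, K u v = 1) (x : U → Bool) :
    ∑ v, chiSq (fun b ↦ ∑ u, N u * K u v * bsc p (x u) b)
        (fun b ↦ ∑ u, M u * K u v * bsc p (x u) b) ≤
      (1 - (1 - 2 * p) ^ 2) * chiSq (N ᵥ* K) (M ᵥ* K) + (1 - 2 * p) ^ 2 * chiSq N M := by
  rw [← sum_chiSq_mul_stochastic N M hK1, chiSq, mul_sum, mul_sum, ← sum_add_distrib]
  refine sum_le_sum fun v _ ↦ chiSq_bsc_le hp0 hp1 (fun u ↦ ?_) x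
  rw [abs_mul, abs_of_nonneg (hK0 u v)]
  exact mul_le_mul_of_nonneg_right (h u) (hK0 u v)

end BinarySymmetricChannel

section BlockBSC

variable {p : ℝ} {U : Type*} {n : ℕ}

/-- The transition matrix from `u` to the outputs of `n` uses of the binary symmetric channel with
inputs `x u 0, …, x u (n - 1)`. -/
noncomputable def blockBSC (p : ℝ) (x : U → Fin n → Bool) : Matrix U (Fin n → Bool) ℝ :=
  of fun u v ↦ ∏ i, bsc p (x u i) (v i)

theorem blockBSC_nonneg (hp0 : 0 ≤ p) (hp1 : p ≤ 1) (x : U → Fin n → Bool) (u : U)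
    (v : Fin n → Bool) : 0 ≤ blockBSC p x u v := by
  rw [blockBSC, of_apply]
  exact prod_nonneg fun _ _ ↦ bsc_nonneg hp0 hp1 _ _

theorem sum_blockBSC (p : ℝ) (x : U → Fin n → Bool) (u : U) : ∑ v, blockBSC p x u v = 1 := by
  simp only [blockBSC, of_apply]
  rw [← Fintype.prod_sum]
  exact prod_eq_one fun _ _ ↦ sum_bsc p _

theorem blockBSC_snoc (p : ℝ) (x : U → Fin (n + 1) → Bool) (u : U) (v : Fin n → Bool) (b : Bool) :
    blockBSC p x u (Fin.snoc v b) =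
      blockBSC p (fun u ↦ Fin.init (x u)) u v * bsc p (x u (Fin.last n)) b := by
  simp only [blockBSC, of_apply, Fin.prod_univ_castSucc, Fin.snoc_castSucc, Fin.snoc_last, Fin.init]

variable [Fintype U]

theorem sum_vecMul_blockBSC_snoc (p : ℝ) (N : U → ℝ) (x : U → Fin (n + 1) → Bool)
    (v : Fin n → Bool) :
    ∑ b, (N ᵥ* blockBSC p x) (Fin.snoc v b) = (N ᵥ* blockBSC p fun u ↦ Fin.init (x u)) v := by
  simp only [vecMul, dotProduct, blockBSC_snoc]
  rw [sum_comm]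
  simp only [← mul_sum, sum_bsc, mul_one]

theorem vecMul_blockBSC_init (p : ℝ) {k : ℕ} (N : (Fin (k + 1) → Bool) → ℝ)
    (x : (Fin k → Bool) → Fin n → Bool) :
    (N ᵥ* blockBSC p fun u ↦ x (Fin.init u)) =
      (fun u ↦ ∑ b, N (Fin.snoc u b)) ᵥ* blockBSC p x := by
  ext v
  simp only [vecMul, dotProduct, sum_snoc, sum_mul, blockBSC, of_apply, Fin.init_snoc]

theorem chiSq_vecMul_blockBSC_succ_le (hp0 : 0 ≤ p) (hp1 : p ≤ 1) {N M : U → ℝ}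
    (h : ∀ u, |N u| ≤ M u) (x : U → Fin (n + 1) → Bool) :
    chiSq (N ᵥ* blockBSC p x) (M ᵥ* blockBSC p x) ≤
      (1 - (1 - 2 * p) ^ 2) * chiSq (N ᵥ* blockBSC p fun u ↦ Fin.init (x u))
          (M ᵥ* blockBSC p fun u ↦ Fin.init (x u)) +
        (1 - 2 * p) ^ 2 * chiSq N M := by
  have hstep := sum_chiSq_mul_bsc_le hp0 hp1 h (blockBSC_nonneg hp0 hp1 fun u ↦ Fin.init (x u))
    (sum_blockBSC p _) fun u ↦ x u (Fin.last n)
  have hsplit : chiSq (N ᵥ* blockBSC p x) (M ᵥ* blockBSC p x) = ∑ v, chiSq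
      (fun b ↦ (N ᵥ* blockBSC p x) (Fin.snoc v b)) (fun b ↦ (M ᵥ* blockBSC p x) (Fin.snoc v b)) :=
    sum_snoc _
  simpa only [hsplit, vecMul, dotProduct, blockBSC_snoc, mul_assoc] using hstep

end BlockBSC

/-- The sign of a bit, `1` for `true` and `-1` for `false`. -/
def bitSign (b : Bool) : ℝ := if b then 1 else -1

theorem bitSign_sq (b : Bool) : bitSign b ^ 2 = 1 := by
  cases b <;> simp [bitSign]

theorem abs_bitSign (b : Bool) : |bitSign b| = 1 := by
  cases b <;> simp [bitSign]

theorem bitSign_mul_bitSign (a b : Bool) :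
    bitSign a * bitSign b = 1 - 2 * if a ≠ b then 1 else 0 := by
  cases a <;> cases b <;> norm_num [bitSign]

namespace Protocol

variable {r n : ℕ} {p : ℝ}

/-- The protocol for the chain without its last hop. -/
def dropRelay (P : Protocol (r + 1) n) : Protocol r n where
  encode := P.encode
  relay j := P.relay j.castSucc
  decode := P.decode

/-- The protocol stopped one time step earlier, where the decoder supplies the missing bit
arbitrarily. -/
def dropTime (P : Protocol r (n + 1)) : Protocol r n where
  encode i := P.encode i.castSucc
  relay j i := P.relay j i.castSucc
  decode v := P.decode (Fin.snoc v false)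

/-- The bits that the last relay sends when the first `k` bits it receives are `u`. By causality,
`k = n - 1` is enough. -/
def relayInput (P : Protocol (r + 1) n) {k : ℕ} (hk : n ≤ k + 1) (u : Fin k → Bool) (i : Fin n) :
    Bool :=
  P.relay (Fin.last r) i fun t ↦ u (Fin.castLE (by omega) t)

/-- The weights of the sequences received by the last node, when the source bit `θ` has weight
`w θ`. A probability vector `w` gives a law. Signed weights give the expectation of a function of
the source bit on each event. -/
noncomputable def outputWeight (p : ℝ) (w : Bool → ℝ) :
    {r : ℕ} → Protocol r n → (Fin n → Bool) → ℝ
  | 0, P => w ᵥ* blockBSC p fun θ i ↦ P.encode i θ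
  | _ + 1, P => P.dropRelay.outputWeight p w ᵥ* blockBSC p (P.relayInput n.le_succ)

theorem init_relayInput (P : Protocol (r + 1) (n + 1)) {k : ℕ} (hk : n + 1 ≤ k + 1 + 1)
    (u : Fin (k + 1) → Bool) :
    Fin.init (P.relayInput hk u) =
      P.dropTime.relayInput (Nat.le_of_succ_le_succ hk) (Fin.init u) :=
  rfl

theorem sum_outputWeight (P : Protocol r n) (p : ℝ) (w : Bool → ℝ) :
    ∑ v, P.outputWeight p w v = ∑ θ, w θ := by
  induction r with
  | zero => exact sum_vecMul_stochastic w (sum_blockBSC p _)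
  | succ r ih => exact (sum_vecMul_stochastic _ (sum_blockBSC p _)).trans (ih P.dropRelay)

theorem abs_outputWeight_le (P : Protocol r n) (hp0 : 0 ≤ p) (hp1 : p ≤ 1) {w W : Bool → ℝ}
    (h : ∀ θ, |w θ| ≤ W θ) (v : Fin n → Bool) :
    |P.outputWeight p w v| ≤ P.outputWeight p W v := by
  induction r generalizing v with
  | zero => exact abs_vecMul_le h (blockBSC_nonneg hp0 hp1 _) v
  | succ r ih => exact abs_vecMul_le (ih P.dropRelay) (blockBSC_nonneg hp0 hp1 _) v

theorem sum_outputWeight_snoc (P : Protocol r (n + 1)) (p : ℝ) (w : Bool → ℝ) (v : Fin n → Bool) :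
    ∑ b, P.outputWeight p w (Fin.snoc v b) = P.dropTime.outputWeight p w v := by
  induction r generalizing v with
  | zero => exact sum_vecMul_blockBSC_snoc p w _ v
  | succ r ih =>
    simp only [outputWeight, sum_vecMul_blockBSC_snoc, init_relayInput, vecMul_blockBSC_init, ih]
    rfl

theorem outputWeight_succ_succ (P : Protocol (r + 1) (n + 1)) (p : ℝ) (w : Bool → ℝ) :
    P.outputWeight p w =
      P.dropRelay.dropTime.outputWeight p w ᵥ* blockBSC p (P.relayInput le_rfl) := by
  rw [← funext (P.dropRelay.sum_outputWeight_snoc p w), ← vecMul_blockBSC_init]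
  rfl

/-- The chi-square information about the sign of the source bit carried by the sequence that the
last node receives. -/
noncomputable def info (P : Protocol r n) (p : ℝ) : ℝ :=
  chiSq (P.outputWeight p fun θ ↦ bitSign θ / 2) (P.outputWeight p fun _ ↦ 1 / 2)

theorem abs_outputWeight_bitSign_le (P : Protocol r n) (hp0 : 0 ≤ p) (hp1 : p ≤ 1)
    (v : Fin n → Bool) :
    |P.outputWeight p (fun θ ↦ bitSign θ / 2) v| ≤ P.outputWeight p (fun _ ↦ 1 / 2) v :=
  P.abs_outputWeight_le hp0 hp1 (fun θ ↦ by rw [abs_div, abs_bitSign, abs_two]) v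

theorem info_time_zero (P : Protocol r 0) (p : ℝ) : P.info p = 0 := by
  have hsum := P.sum_outputWeight p fun θ ↦ bitSign θ / 2
  have hbalanced : ∑ θ, bitSign θ / 2 = 0 := by norm_num [bitSign]
  rw [Fintype.sum_unique, hbalanced] at hsum
  rw [info, chiSq, Fintype.sum_unique, hsum, zero_pow two_ne_zero, zero_div]

theorem info_source_le (P : Protocol 0 (n + 1)) (hp0 : 0 ≤ p) (hp1 : p ≤ 1) :
    P.info p ≤ (1 - (1 - 2 * p) ^ 2) * P.dropTime.info p + (1 - 2 * p) ^ 2 := by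
  have hbit : chiSq (fun θ ↦ bitSign θ / 2) (fun _ ↦ 1 / 2) = 1 := by norm_num [chiSq, bitSign]
  have hstep := chiSq_vecMul_blockBSC_succ_le hp0 hp1
    (N := fun θ ↦ bitSign θ / 2) (M := fun _ ↦ 1 / 2)
    (fun θ ↦ by rw [abs_div, abs_bitSign, abs_two]) fun θ i ↦ P.encode i θ
  rwa [hbit, mul_one] at hstep

theorem info_relay_le (P : Protocol (r + 1) (n + 1)) (hp0 : 0 ≤ p) (hp1 : p ≤ 1) :
    P.info p ≤ (1 - (1 - 2 * p) ^ 2) * P.dropTime.info p +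
      (1 - 2 * p) ^ 2 * P.dropRelay.dropTime.info p := by
  rw [info, outputWeight_succ_succ, outputWeight_succ_succ]
  exact chiSq_vecMul_blockBSC_succ_le hp0 hp1
    (P.dropRelay.dropTime.abs_outputWeight_bitSign_le hp0 hp1) (P.relayInput le_rfl)

theorem pow_succ_mul_convexCombo_le {η c g I J : ℝ} {r n : ℕ} (hη0 : 0 ≤ η) (hη1 : η ≤ 1)
    (hc : 0 ≤ c) (hg : g = 1 + η * (c - 1)) (hI : c ^ (r + 1) * I ≤ g ^ n)
    (hJ : c ^ r * J ≤ g ^ n) :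
    c ^ (r + 1) * ((1 - η) * I + η * J) ≤ g ^ (n + 1) :=
  calc c ^ (r + 1) * ((1 - η) * I + η * J)
      = (1 - η) * (c ^ (r + 1) * I) + η * c * (c ^ r * J) := by ring
    _ ≤ (1 - η) * g ^ n + η * c * g ^ n := by
      have := sub_nonneg.2 hη1
      gcongr
    _ = g ^ (n + 1) := by rw [hg]; ring

theorem pow_mul_info_le (P : Protocol r n) (hp0 : 0 ≤ p) (hp1 : p ≤ 1) {c : ℝ} (hc : 1 ≤ c) :
    c ^ (r + 1) * P.info p ≤ (1 + (1 - 2 * p) ^ 2 * (c - 1)) ^ n := by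
  have hη0 : 0 ≤ (1 - 2 * p) ^ 2 := sq_nonneg _
  have hη1 : (1 - 2 * p) ^ 2 ≤ 1 := by nlinarith
  have hc0 : 0 ≤ c := zero_le_one.trans hc
  have hg : 1 ≤ 1 + (1 - 2 * p) ^ 2 * (c - 1) :=
    le_add_of_nonneg_right (mul_nonneg hη0 (sub_nonneg.2 hc))
  induction n generalizing r with
  | zero => simp [info_time_zero]
  | succ n ih =>
    cases r with
    | zero =>
      refine (mul_le_mul_of_nonneg_left (P.info_source_le hp0 hp1) (by positivity)).trans ?_
      have hstep := pow_succ_mul_convexCombo_le hη0 hη1 hc0 rfl (ih P.dropTime)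
        (J := 1) (by simpa using one_le_pow₀ hg)
      rwa [mul_one] at hstep
    | succ r =>
      exact (mul_le_mul_of_nonneg_left (P.info_relay_le hp0 hp1) (by positivity)).trans
        (pow_succ_mul_convexCombo_le hη0 hη1 hc0 rfl (ih P.dropTime) (ih P.dropRelay.dropTime))

theorem prod_bsc_input_snoc (P : Protocol (r + 1) n) (p : ℝ) (θ : Bool)
    (y : Fin (r + 1) → Fin n → Bool) (v : Fin n → Bool) :
    ∏ j, ∏ i, bsc p (P.input θ (Fin.snoc y v : Fin (r + 2) → Fin n → Bool) j i)
        ((Fin.snoc y v : Fin (r + 2) → Fin n → Bool) j i) =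
      (∏ j, ∏ i, bsc p (P.dropRelay.input θ y j i) (y j i)) *
        blockBSC p (P.relayInput n.le_succ) (y (Fin.last r)) v := by
  have hinit (z : Fin (r + 2) → Fin n → Bool) (j : Fin (r + 1)) :
      P.input θ z j.castSucc = P.dropRelay.input θ (Fin.init z) j := by
    cases j using Fin.cases <;> rfl
  have hlast (z : Fin (r + 2) → Fin n → Bool) :
      P.input θ z (Fin.last (r + 1)) = P.relayInput n.le_succ (Fin.init z (Fin.last r)) := rfl
  rw [Fin.prod_univ_castSucc]
  simp only [hinit, hlast, Fin.init_snoc, Fin.snoc_castSucc, Fin.snoc_last, blockBSC, of_apply]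

theorem sum_mul_prod_bsc_input (P : Protocol r n) (p : ℝ) (w : Bool → ℝ)
    (F : (Fin n → Bool) → ℝ) :
    ∑ θ, ∑ y : Fin (r + 1) → Fin n → Bool,
        w θ * F (y (Fin.last r)) * ∏ j, ∏ i, bsc p (P.input θ y j i) (y j i) =
      ∑ v, F v * P.outputWeight p w v := by
  induction r generalizing F with
  | zero =>
    rw [sum_comm, ← (Equiv.funUnique (Fin 1) (Fin n → Bool)).symm.sum_comp]
    refine sum_congr rfl fun v _ ↦ ?_
    rw [outputWeight, vecMul, dotProduct, mul_sum]
    refine sum_congr rfl fun θ _ ↦ ?_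
    rw [Fin.prod_univ_one, mul_comm (w θ), mul_assoc]
    rfl
  | succ r ih =>
    calc ∑ θ, ∑ y : Fin (r + 2) → Fin n → Bool,
          w θ * F (y (Fin.last (r + 1))) * ∏ j, ∏ i, bsc p (P.input θ y j i) (y j i)
        = ∑ θ, ∑ v, ∑ y : Fin (r + 1) → Fin n → Bool,
          w θ * (F v * blockBSC p (P.relayInput n.le_succ) (y (Fin.last r)) v) *
            ∏ j, ∏ i, bsc p (P.dropRelay.input θ y j i) (y j i) := by
          refine sum_congr rfl fun θ _ ↦ ?_
          rw [sum_snoc, sum_comm]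
          simp only [prod_bsc_input_snoc, Fin.snoc_last]
          refine sum_congr rfl fun v _ ↦ sum_congr rfl fun y _ ↦ ?_
          ring
      _ = ∑ v, ∑ u, F v * blockBSC p (P.relayInput n.le_succ) u v *
            P.dropRelay.outputWeight p w u := by
          rw [sum_comm]
          exact sum_congr rfl fun v _ ↦
            ih P.dropRelay fun u ↦ F v * blockBSC p (P.relayInput n.le_succ) u v
      _ = ∑ v, F v * P.outputWeight p w v := by
          refine sum_congr rfl fun v _ ↦ ?_
          simp only [outputWeight, vecMul, dotProduct, mul_sum]
          exact sum_congr rfl fun u _ ↦ by ring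

theorem one_sub_two_mul_errorProb (P : Protocol r n) (p : ℝ) :
    1 - 2 * P.errorProb p =
      ∑ v, bitSign (P.decode v) * P.outputWeight p (fun θ ↦ bitSign θ / 2) v := by
  have htotal : ∑ θ, ∑ y, P.jointProb p θ y = 1 := by
    have hprior : ∑ _θ : Bool, (1 / 2 : ℝ) = 1 := by norm_num
    simpa only [jointProb, mul_one, one_mul, sum_outputWeight, hprior] using
      P.sum_mul_prod_bsc_input p (fun _ ↦ 1 / 2) fun _ ↦ 1
  rw [← sum_mul_prod_bsc_input, ← htotal, errorProb, mul_sum, ← sum_sub_distrib]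
  refine sum_congr rfl fun θ _ ↦ ?_
  rw [mul_sum, ← sum_sub_distrib]
  refine sum_congr rfl fun y _ ↦ ?_
  rw [div_mul_eq_mul_div, mul_comm (bitSign θ), bitSign_mul_bitSign, jointProb]
  split_ifs <;> ring

theorem sq_one_sub_two_mul_errorProb_le_info (P : Protocol r n) (hp0 : 0 ≤ p) (hp1 : p ≤ 1) :
    (1 - 2 * P.errorProb p) ^ 2 ≤ P.info p := by
  have hcs := sq_sum_le_sum_mul_sum_sq_div (s := univ)
    (N := fun v ↦ bitSign (P.decode v) * P.outputWeight p (fun θ ↦ bitSign θ / 2) v)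
    (M := P.outputWeight p fun _ ↦ 1 / 2) fun v _ ↦ by
      rw [abs_mul, abs_bitSign, one_mul]
      exact P.abs_outputWeight_bitSign_le hp0 hp1 v
  have hprior : ∑ _θ : Bool, (1 / 2 : ℝ) = 1 := by norm_num
  simp only [mul_pow, bitSign_sq, one_mul] at hcs
  rwa [← one_sub_two_mul_errorProb, sum_outputWeight, hprior, one_mul] at hcs

theorem pow_mul_sq_le_of_errorProb_le (P : Protocol r n) (hp0 : 0 ≤ p) (hp1 : p ≤ 1) {ε c : ℝ}
    (hε : ε ≤ 1 / 2) (hP : P.errorProb p ≤ ε) (hc : 1 ≤ c) :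
    c ^ (r + 1) * (1 - 2 * ε) ^ 2 ≤ (1 + (1 - 2 * p) ^ 2 * (c - 1)) ^ n := by
  refine le_trans ?_ (P.pow_mul_info_le hp0 hp1 hc)
  have hsq : (1 - 2 * ε) ^ 2 ≤ P.info p :=
    (pow_le_pow_left₀ (by linarith) (by linarith) 2).trans
      (P.sq_one_sub_two_mul_errorProb_le_info hp0 hp1)
  gcongr

end Protocol

open Filter

theorem exists_one_lt_exp_mul_sub_one_lt {s : ℝ} (hs0 : 0 ≤ s) (hs1 : s < 1) :
    ∃ c, 1 < c ∧ Real.exp (s * (c - 1)) < c := by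
  have hc : 1 < 2 / (1 + s) := by rw [lt_div_iff₀ (by linarith)]; linarith
  refine ⟨2 / (1 + s), hc, (Real.lt_log_iff_exp_lt (by positivity)).1 ?_⟩
  refine lt_of_lt_of_le ?_ (Real.one_sub_inv_le_log_of_pos (by positivity))
  have hgap : 1 - (2 / (1 + s))⁻¹ - s * (2 / (1 + s) - 1) = (1 - s) ^ 2 / (2 * (1 + s)) := by
    field_simp
    ring
  rw [← sub_pos, hgap]
  have := sub_pos.2 hs1
  positivity

theorem eventually_le_mul_of_pow_mul_le {η C a : ℝ} (hη : 0 ≤ η) (hηC : η < C) (ha : 0 < a) :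
    ∀ᶠ m : ℕ in atTop, ∀ n : ℕ,
      (∀ c : ℝ, 1 ≤ c → c ^ m * a ≤ (1 + η * (c - 1)) ^ n) → (m : ℝ) ≤ C * n := by
  have hC : 0 < C := hη.trans_lt hηC
  obtain ⟨c, hc1, hc⟩ := exists_one_lt_exp_mul_sub_one_lt (div_nonneg hη hC.le)
    ((div_lt_one hC).2 hηC)
  have hc0 : 0 < c := zero_lt_one.trans hc1
  have hlim := tendsto_pow_atTop_nhds_zero_of_lt_one (by positivity) ((div_lt_one hc0).2 hc)
  filter_upwards [hlim.eventually_lt_const ha] with m hm n hbound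
  by_contra! hn
  refine (hbound c hc1.le).not_gt ?_
  have hrate : 0 ≤ η / C * (c - 1) := mul_nonneg (div_nonneg hη hC.le) (sub_nonneg.2 hc1.le)
  calc (1 + η * (c - 1)) ^ n
      ≤ Real.exp (η * (c - 1)) ^ n := by
        have := mul_nonneg hη (sub_nonneg.2 hc1.le)
        gcongr
        linarith [Real.add_one_le_exp (η * (c - 1))]
    _ = Real.exp (η / C * (c - 1) * (C * n)) := by
        rw [← Real.exp_nat_mul]
        congr 1
        field_simp
    _ ≤ Real.exp (η / C * (c - 1) * m) := by gcongr
    _ = Real.exp (η / C * (c - 1)) ^ m := by rw [← Real.exp_nat_mul, mul_comm]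
    _ < c ^ m * a := by rwa [div_pow, div_lt_iff₀' (by positivity)] at hm

theorem le_mul_minBlockLength {ε p : ℝ} {r : ℕ} {a C : ENNReal} (hC : C ≠ 0)
    (h : ∀ (n : ℕ) (P : Protocol r n), P.errorProb p ≤ ε → a ≤ C * n) :
    a ≤ C * minBlockLength ε p r := by
  rcases Set.eq_empty_or_nonempty
    {N : ℕ∞ | ∃ n : ℕ, N = n ∧ ∃ P : Protocol r n, P.errorProb p ≤ ε} with hnone | hsome
  · rw [minBlockLength, hnone, sInf_empty, ENat.toENNReal_top, ENNReal.mul_top hC]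
    exact le_top
  · obtain ⟨n, hn, P, hP⟩ := csInf_mem hsome
    rw [minBlockLength, hn, ENat.toENNReal_coe]
    exact h n P hP

theorem informationVelocity_le_of_sq_lt {ε p C : ℝ} (hp0 : 0 ≤ p) (hp1 : p ≤ 1) (hε : ε < 1 / 2)
    (hC : (1 - 2 * p) ^ 2 < C) : informationVelocity ε p ≤ ENNReal.ofReal C := by
  have hC0 : 0 < C := (sq_nonneg _).trans_lt hC
  have ha : 0 < (1 - 2 * ε) ^ 2 := pow_pos (by linarith) 2
  refine limsup_le_of_le (h := ?_)
  filter_upwards [(tendsto_add_atTop_nat 1).eventually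
    (eventually_le_mul_of_pow_mul_le (sq_nonneg _) hC ha)] with r hr
  refine ENNReal.div_le_of_le_mul (le_mul_minBlockLength (by simpa using hC0) fun n P hP ↦ ?_)
  rw [← ENNReal.ofReal_natCast, ← ENNReal.ofReal_natCast n, ← ENNReal.ofReal_mul hC0.le]
  exact ENNReal.ofReal_le_ofReal <| hr n fun c hc ↦
    P.pow_mul_sq_le_of_errorProb_le hp0 hp1 hε.le hP hc

end RelayChain

theorem proposition1_general {p ε : ℝ} (hp0 : 0 ≤ p) (hp1 : p ≤ 1) (hε : ε < 1 / 2) :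
    RelayChain.informationVelocity ε p ≤ ENNReal.ofReal ((1 - 2 * p) ^ 2) := by
  refine ENNReal.le_of_forall_pos_le_add fun x hx _ ↦ ?_
  rw [← ENNReal.ofReal_coe_nnreal, ← ENNReal.ofReal_add (sq_nonneg _) x.coe_nonneg]
  exact RelayChain.informationVelocity_le_of_sq_lt hp0 hp1 hε
    (lt_add_of_pos_right _ (by exact_mod_cast hx))

theorem proposition1 (δ : ℝ) (hδ0 : 0 < δ) (hδ1 : δ < 1) (ε : ℝ) (hε0 : 0 < ε) (hε1 : ε < 1 / 2) :
    RelayChain.informationVelocity ε ((1 - δ) / 2) ≤ ENNReal.ofReal (δ ^ 2) := by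
  simpa [show 1 - 2 * ((1 - δ) / 2) = δ by ring] using
    proposition1_general (p := (1 - δ) / 2) (by linarith) (by linarith) hε1
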